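/- Let $n\ge 1$ and let $P$ be a complex polynomial of degree $n$ having all its zeros in $|z|\le k$, where $0<k\le 1$. Put $m=\min_{|z|=k}|P(z)|$ and let $D_\alpha P(z)=nP(z)+(\alpha-z)P'(z)$ be the polar derivative of $P$ with respect to $\alpha\in\mathbb C$. Then for all $\alpha,\beta\in\mathbb C$ with $|\alpha|\ge k$ and $|\beta|\le 1$, and for every real $p>0$, $$n(|\alpha|-k)\left(\int_0^{2\pi}\left|\frac{P(e^{i\theta})+\frac{m\beta}{k^{n-1}}}{|D_\alpha P(e^{i\theta})|-\frac{nm}{k^{n-1}}}\right|^p d\theta\right)^{1/p}\le\left(\int_0^{2\pi}|1+ke^{i\theta}|^p\,d\theta\right)^{1/p}.$$ If $|\alpha|>k$, the denominator is nonzero for almost every $\theta$ and the integral on the left is finite; if $|\alpha|=k$, the left-hand side is read as $0$. The inequality is sharp: equality holds for $P(z)=(z-k)^n$ and every real $\alpha>k$. -/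

import Mathlib

open Polynomial MeasureTheory

/-- The polar derivative `D_α P(z) = n P(z) + (α - z) P'(z)`, where `n` is the degree of `P`. -/
noncomputable def polarDeriv (α : ℂ) (P : ℂ[X]) : ℂ[X] :=
  (P.natDegree : ℂ[X]) * P + (C α - X) * derivative P

/-- The minimum of `|P(z)|` over the circle `|z| = k`. -/
noncomputable def minModulus (P : ℂ[X]) (k : ℝ) : ℝ :=
  sInf ((fun z : ℂ => ‖P.eval z‖) '' Metric.sphere (0 : ℂ) k)

/-- For `k ≥ 0` the infimum defining `minModulus` is attained, so it is a genuine minimum. -/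
theorem isLeast_minModulus (P : ℂ[X]) {k : ℝ} (hk : 0 ≤ k) :
    IsLeast ((fun z : ℂ => ‖P.eval z‖) '' Metric.sphere (0 : ℂ) k) (minModulus P k) := by
  refine IsCompact.isLeast_sInf ((isCompact_sphere (0 : ℂ) k).image (by fun_prop)) ?_
  exact (NormedSpace.sphere_nonempty.mpr hk).image _

/-- The denominator `|D_α P(e^{iθ})| - n m / k^{n-1}`, with `n` the degree of `P` and
`m = min_{|z|=k} |P(z)|`. -/
noncomputable def polarDenom (P : ℂ[X]) (k : ℝ) (α : ℂ) (θ : ℝ) : ℝ :=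
  ‖(polarDeriv α P).eval (Complex.exp (θ * Complex.I))‖
    - P.natDegree * minModulus P k / k ^ (P.natDegree - 1)

/-- The quotient `(P(e^{iθ}) + m β / k^{n-1}) / (|D_α P(e^{iθ})| - n m / k^{n-1})`. -/
noncomputable def polarQuotient (P : ℂ[X]) (k : ℝ) (α β : ℂ) (θ : ℝ) : ℂ :=
  (P.eval (Complex.exp (θ * Complex.I)) + minModulus P k * β / (k : ℂ) ^ (P.natDegree - 1))
    / (polarDenom P k α θ : ℂ)

/-! Write `n (P + mβ/k^(n-1)) = z P' (1 + w)`. Everything follows from one inequality for `|z| ≥ k`: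
`|nP - zP'| + (nm/k^(n-1)) |z|^(n-1) ≤ k |P'|`. On `|z| = 1` it bounds the denominator below by
`(|α| - k) |P'|`, because `D_α P = αP' + (nP - zP')`; for `|z| ≥ 1` it gives `|w(z)| ≤ k/|z|`. Hence
`n(|α| - k)` times the quotient is at most `|1 + w|` almost everywhere, and Littlewood
subordination, in the variable `1/z`, compares the `p`-means of `1 + w` and `1 + kz`.

The inequality with `m = 0` holds because `zP'/P` is a sum of `n` terms `z/(z - r)`, each in a
convex region. The gain in `m` comes from applying this to `P - l z^n` with `|l| < m/k^n`: its zeros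
stay in `|z| ≤ k`, and `nP - zP'` does not change. -/

/-! ### Subordination on the unit circle. -/

/-- **Littlewood's subordination principle** for the norm of an analytic function. -/
theorem circleAverage_norm_comp_le {G f : ℂ → ℂ} {s : ℝ}
    (hG : DiffContOnCl ℂ G (Metric.ball 0 s)) (hf : DiffContOnCl ℂ f (Metric.ball 0 1))
    (hf0 : f 0 = 0) (hfs : ∀ z ∈ Metric.closedBall (0 : ℂ) 1, ‖f z‖ < s) :
    Real.circleAverage (fun z => ‖G (f z)‖) 0 1 ≤ Real.circleAverage (fun z => ‖G z‖) 0 s := by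
  have hs : 0 < s := by simpa [hf0] using hfs 0 (by simp)
  have hfc : ContinuousOn f (Metric.closedBall 0 1) := hf.continuousOn_ball
  have hGc : ContinuousOn G (Metric.closedBall 0 s) := hG.continuousOn_ball
  have hmem1 (θ : ℝ) : circleMap 0 1 θ ∈ Metric.closedBall (0 : ℂ) 1 := by simp
  have hmems (θ : ℝ) : circleMap 0 s θ ∈ Metric.closedBall (0 : ℂ) s := by simp [abs_of_pos hs]
  have hfθ : Continuous fun θ : ℝ => f (circleMap 0 1 θ) :=
    hfc.comp_continuous (continuous_circleMap 0 1) hmem1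
  have hGφ : Continuous fun φ : ℝ => G (circleMap 0 s φ) :=
    hGc.comp_continuous (continuous_circleMap 0 s) hmems
  have hne {z : ℂ} (hz : z ∈ Metric.closedBall (0 : ℂ) 1) (φ : ℝ) : circleMap 0 s φ - f z ≠ 0 := by
    intro h
    have h1 := hfs z hz
    rw [← sub_eq_zero.mp h] at h1
    simp [abs_of_pos hs] at h1
  -- `‖G‖` at `f(e^{iθ})` is at most the Poisson integral of `‖G‖` over `|z| = s`. Averaging over
  -- `θ` and swapping integrals leaves only the `θ`-mean of the kernel, which is 1.
  set K : ℝ → ℝ → ℝ := fun θ φ => poissonKernel 0 (f (circleMap 0 1 θ)) (circleMap 0 s φ) with hK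
  have hKc : Continuous (Function.uncurry K) := by
    have h1 : Continuous fun x : ℝ × ℝ => f (circleMap 0 1 x.1) := hfθ.comp continuous_fst
    have h2 : Continuous fun x : ℝ × ℝ => circleMap 0 s x.2 :=
      (continuous_circleMap 0 s).comp continuous_snd
    simp only [hK, poissonKernel_def, Function.uncurry_def, sub_zero]
    refine Continuous.div ((h2.norm.pow 2).sub (h1.norm.pow 2)) ((h2.sub h1).norm.pow 2) fun x => ?_
    exact pow_ne_zero _ (norm_ne_zero_iff.mpr (hne (hmem1 x.1) x.2))
  have hK0 (θ φ : ℝ) : 0 ≤ K θ φ := by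
    simp only [hK, poissonKernel_def, sub_zero]
    refine div_nonneg (sub_nonneg.mpr ?_) (by positivity)
    have := hfs _ (hmem1 θ)
    simp only [norm_circleMap_zero, abs_of_pos hs]
    gcongr
  have hpi : (0 : ℝ) ≤ 2 * Real.pi := Real.two_pi_pos.le
  have hFc : Continuous (Function.uncurry fun θ φ => K θ φ * ‖G (circleMap 0 s φ)‖) := by
    have h2 : Continuous fun x : ℝ × ℝ => G (circleMap 0 s x.2) := hGφ.comp continuous_snd
    exact hKc.mul h2.norm
  have hpt (θ : ℝ) : ‖G (f (circleMap 0 1 θ))‖ ≤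
      (2 * Real.pi)⁻¹ * ∫ φ in (0 : ℝ)..2 * Real.pi, K θ φ * ‖G (circleMap 0 s φ)‖ := by
    have hw : f (circleMap 0 1 θ) ∈ Metric.ball (0 : ℂ) s := by simpa using hfs _ (hmem1 θ)
    rw [← hG.circleAverage_poissonKernel_smul hw, Real.circleAverage_def, norm_smul,
      Real.norm_of_nonneg (by positivity)]
    gcongr
    refine (intervalIntegral.norm_integral_le_integral_norm hpi).trans_eq ?_
    refine intervalIntegral.integral_congr fun φ _ => ?_
    simp only [Pi.smul_apply', norm_smul, Real.norm_eq_abs, hK]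
    rw [abs_of_nonneg (hK0 θ φ)]
  -- The Poisson kernel is the real part of the Herglotz–Riesz kernel, which is holomorphic in `f
  -- z`; the mean value property evaluates it at `f 0 = 0`.
  have hmean (φ : ℝ) : (2 * Real.pi)⁻¹ * ∫ θ in (0 : ℝ)..2 * Real.pi, K θ φ = 1 := by
    set H : ℂ → ℂ := fun z => herglotzRieszKernel 0 (f z) (circleMap 0 s φ) with hH
    have hHd : DiffContOnCl ℂ H (Metric.ball 0 |1|) := by
      rw [abs_one]
      have h1 : DiffContOnCl ℂ (fun _ : ℂ => circleMap 0 s φ) (Metric.ball 0 1) :=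
        diffContOnCl_const
      simp only [hH, herglotzRieszKernel_def, sub_zero, div_eq_mul_inv]
      refine (h1.add hf).smul ((h1.sub hf).inv fun z hz => hne ?_ φ)
      rwa [closure_ball _ one_ne_zero] at hz
    have hHi : CircleIntegrable H 0 1 := by
      refine ContinuousOn.circleIntegrable zero_le_one ?_
      have := hHd.continuousOn_ball
      rw [abs_one] at this
      exact this.mono Metric.sphere_subset_closedBall
    have h2 := hHd.circleAverage
    have h3 := Complex.reCLM.circleAverage_comp_comm hHi
    rw [h2] at h3
    have h4 : H 0 = 1 := by
      have : circleMap 0 s φ ≠ 0 := by simpa [hf0] using hne (z := 0) (by simp) φ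
      simp [hH, herglotzRieszKernel_def, hf0, this]
    rw [h4, Real.circleAverage_def, smul_eq_mul] at h3
    simpa [hK, poissonKernel_eq_re_herglotzRieszKernel, hH] using h3
  rw [Real.circleAverage_def, Real.circleAverage_def, smul_eq_mul, smul_eq_mul]
  gcongr
  have hGf : Continuous fun θ : ℝ => ‖G (f (circleMap 0 1 θ))‖ := by
    refine (hGc.comp_continuous hfθ fun θ => ?_).norm
    simpa using (hfs _ (hmem1 θ)).le
  calc ∫ θ in (0 : ℝ)..2 * Real.pi, ‖G (f (circleMap 0 1 θ))‖
      ≤ ∫ θ in (0 : ℝ)..2 * Real.pi, (2 * Real.pi)⁻¹ *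
          ∫ φ in (0 : ℝ)..2 * Real.pi, K θ φ * ‖G (circleMap 0 s φ)‖ := by
        refine intervalIntegral.integral_mono hpi (hGf.intervalIntegrable _ _) ?_ hpt
        refine Continuous.intervalIntegrable (continuous_const.mul ?_) _ _
        exact intervalIntegral.continuous_parametric_intervalIntegral_of_continuous' hFc _ _
    _ = ∫ φ in (0 : ℝ)..2 * Real.pi, ((2 * Real.pi)⁻¹ * ∫ θ in (0 : ℝ)..2 * Real.pi, K θ φ) *
          ‖G (circleMap 0 s φ)‖ := by
        rw [intervalIntegral.integral_const_mul, intervalIntegral_intervalIntegral_swap,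
          ← intervalIntegral.integral_const_mul]
        · refine intervalIntegral.integral_congr fun φ _ => ?_
          simp only [intervalIntegral.integral_mul_const, mul_assoc]
        · refine (hFc.continuousOn.integrableOn_compact
            (isCompact_uIcc.prod isCompact_uIcc)).mono_set
              (Set.prod_mono Set.uIoc_subset_uIcc Set.uIoc_subset_uIcc)
    _ = ∫ φ in (0 : ℝ)..2 * Real.pi, ‖G (circleMap 0 s φ)‖ := by simp only [hmean, one_mul]

/-- Subordination for `|1 + w|^p`, where `w` is analytic outside the unit disc, vanishes at
infinity, and satisfies the Schwarz bound `|w(z)| ≤ k / |z|`. -/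
theorem integral_norm_one_add_rpow_le {w : ℂ → ℂ} {k p : ℝ} (hk0 : 0 < k) (hk1 : k ≤ 1)
    (hp : 0 < p) (hd : ∀ z, 1 < ‖z‖ → DifferentiableAt ℂ w z)
    (hb : ∀ z, 1 ≤ ‖z‖ → ‖w z‖ ≤ k / ‖z‖) (h0 : w 0 = 0)
    (hc : ∀ᵐ θ : ℝ, ContinuousAt w (circleMap 0 1 θ)) :
    ∫ θ in (0 : ℝ)..2 * Real.pi, ‖1 + w (circleMap 0 1 θ)‖ ^ p ≤
      ∫ θ in (0 : ℝ)..2 * Real.pi, ‖1 + k * circleMap 0 1 θ‖ ^ p := by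
  have hmapmul (r θ : ℝ) : circleMap 0 r θ = r * circleMap 0 1 θ := by simp [circleMap]
  -- Dilation by `r ^ 2` keeps `f` off the boundary: `‖f‖ ≤ k r² < k r` on the closed disc. As `k r
  -- < 1`, a branch of `(1 + ζ)^p` is holomorphic on the disc of radius `k r`.
  have key (r : ℝ) (hr0 : 0 < r) (hr1 : r < 1) :
      ∫ θ in (0 : ℝ)..2 * Real.pi, ‖1 + w ((r ^ 2 : ℝ)⁻¹ * circleMap 0 1 θ)‖ ^ p ≤
      ∫ θ in (0 : ℝ)..2 * Real.pi, ‖1 + k * (r * circleMap 0 1 θ)‖ ^ p := by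
    have hr2 : r ^ 2 < 1 := by nlinarith
    have hinv (ζ : ℂ) (h : ζ ≠ 0) (h1 : ‖ζ‖ < (r ^ 2)⁻¹) : 1 < ‖((r ^ 2 : ℝ) * ζ)⁻¹‖ := by
      rw [norm_inv, norm_mul, Complex.norm_real, Real.norm_of_nonneg (by positivity)]
      rw [one_lt_inv₀ (mul_pos (by positivity) (norm_pos_iff.mpr h))]
      rw [lt_inv_comm₀ (norm_pos_iff.mpr h) (by positivity)] at h1
      calc r ^ 2 * ‖ζ‖ < ‖ζ‖⁻¹ * ‖ζ‖ := by gcongr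
        _ = 1 := inv_mul_cancel₀ (norm_ne_zero_iff.mpr h)
    set f : ℂ → ℂ := fun ζ => w (((r ^ 2 : ℝ) * ζ)⁻¹) with hf
    -- Since `0⁻¹ = 0`, the value `w 0 = 0` plays the role of `w(∞) = 0`; the singularity of `f` at
    -- 0 is then removable.
    have hf0 : f 0 = 0 := by simp [hf, h0]
    have hfb (ζ : ℂ) (h1 : ‖ζ‖ < (r ^ 2)⁻¹) : ‖f ζ‖ ≤ k * r ^ 2 * ‖ζ‖ := by
      rcases eq_or_ne ζ 0 with rfl | h
      · simp [hf0]
      refine (hb _ (hinv ζ h h1).le).trans_eq ?_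
      rw [norm_inv, norm_mul, Complex.norm_real, Real.norm_of_nonneg (by positivity), div_inv_eq_mul,
        mul_assoc]
    have hone : 1 < (r ^ 2)⁻¹ := (one_lt_inv₀ (by positivity)).mpr hr2
    have hfd (ζ : ℂ) (h : ζ ≠ 0) (h1 : ‖ζ‖ < (r ^ 2)⁻¹) : DifferentiableAt ℂ f ζ := by
      refine DifferentiableAt.comp ζ (hd _ (hinv ζ h h1)) (DifferentiableAt.inv (by fun_prop) ?_)
      exact mul_ne_zero (by simp [hr0.ne']) h
    have hfd' (ζ : ℂ) (h1 : ‖ζ‖ < (r ^ 2)⁻¹) : DifferentiableAt ℂ f ζ := by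
      rcases eq_or_ne ζ 0 with rfl | h
      swap
      · exact hfd ζ h h1
      have hev : ∀ᶠ ζ : ℂ in nhds 0, ‖ζ‖ < (r ^ 2)⁻¹ :=
        continuous_norm.continuousAt.eventually_lt_const h1
      refine (Complex.analyticAt_of_differentiable_on_punctured_nhds_of_continuousAt
        ?_ ?_).differentiableAt
      · filter_upwards [self_mem_nhdsWithin, mem_nhdsWithin_of_mem_nhds hev] with ζ h2 h3
          using hfd ζ h2 h3
      · rw [ContinuousAt, hf0]
        refine squeeze_zero_norm' (hev.mono hfb) ?_
        have : Continuous fun ζ : ℂ => k * r ^ 2 * ‖ζ‖ := by fun_prop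
        simpa using this.tendsto 0
    have hdc : DiffContOnCl ℂ f (Metric.ball 0 1) := by
      refine DifferentiableOn.diffContOnCl fun ζ hζ => (hfd' ζ ?_).differentiableWithinAt
      rw [closure_ball _ one_ne_zero] at hζ
      exact (mem_closedBall_zero_iff.mp hζ).trans_lt hone
    have hGd : DiffContOnCl ℂ (fun ζ : ℂ => (1 + ζ) ^ (p : ℂ)) (Metric.ball 0 (k * r)) := by
      refine DifferentiableOn.diffContOnCl fun ζ hζ => DifferentiableAt.differentiableWithinAt ?_
      rw [closure_ball _ (by positivity)] at hζ
      refine DifferentiableAt.cpow_const (by fun_prop) ?_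
      refine Complex.mem_slitPlane_of_norm_lt_one ((mem_closedBall_zero_iff.mp hζ).trans_lt ?_)
      nlinarith
    have hmain := circleAverage_norm_comp_le hGd hdc hf0 fun ζ hζ => by
      have h1 : ‖ζ‖ ≤ 1 := mem_closedBall_zero_iff.mp hζ
      calc ‖f ζ‖ ≤ k * r ^ 2 * ‖ζ‖ := hfb ζ (h1.trans_lt hone)
        _ ≤ k * r ^ 2 * 1 := by gcongr
        _ < k * r := by nlinarith [mul_pos hk0 hr0]
    rw [← Real.circleAverage_zero_one_congr_inv, Real.circleAverage_def, Real.circleAverage_def,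
      smul_eq_mul, smul_eq_mul] at hmain
    have := le_of_mul_le_mul_left hmain (by positivity)
    simpa [hf, Complex.norm_cpow_real, hmapmul (k * r), mul_assoc, mul_comm] using this
  have hlim1 : Filter.Tendsto (fun r : ℝ => ∫ θ in (0 : ℝ)..2 * Real.pi,
      ‖1 + w ((r ^ 2 : ℝ)⁻¹ * circleMap 0 1 θ)‖ ^ p) (nhdsWithin 1 (Set.Iio 1))
      (nhds (∫ θ in (0 : ℝ)..2 * Real.pi, ‖1 + w (circleMap 0 1 θ)‖ ^ p)) := by
    have hev : ∀ᶠ r : ℝ in nhdsWithin 1 (Set.Iio 1), 0 < r ∧ r < 1 :=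
      (eventually_nhdsWithin_of_eventually_nhds (lt_mem_nhds zero_lt_one)).and self_mem_nhdsWithin
    have hgt (r : ℝ) (h : 0 < r ∧ r < 1) (θ : ℝ) : 1 < ‖(r ^ 2 : ℝ)⁻¹ * circleMap 0 1 θ‖ := by
      have hr2 : r ^ 2 < 1 := by nlinarith
      have := h.1
      rw [norm_mul, Complex.norm_real, Real.norm_of_nonneg (by positivity)]
      simpa using (one_lt_inv₀ (by positivity)).mpr hr2
    refine intervalIntegral.tendsto_integral_filter_of_dominated_convergence
      (fun _ => 2 ^ p) ?_ ?_ (by simp) ?_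
    · filter_upwards [hev] with r hr
      refine (Continuous.aestronglyMeasurable ?_)
      refine Continuous.rpow_const (continuous_norm.comp (continuous_const.add ?_))
        fun _ => Or.inr hp.le
      refine continuous_iff_continuousAt.mpr fun θ => ?_
      refine ContinuousAt.comp (g := w) (f := fun θ => (r ^ 2 : ℝ)⁻¹ * circleMap 0 1 θ)
        (hd _ (hgt r hr θ)).continuousAt ?_
      exact (continuous_const.mul (continuous_circleMap 0 1)).continuousAt
    · filter_upwards [hev] with r hr
      refine Filter.Eventually.of_forall fun θ _ => ?_
      rw [Real.norm_of_nonneg (by positivity)]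
      gcongr
      refine (norm_add_le _ _).trans ?_
      have h1 := hgt r hr θ
      have h2 := hb _ h1.le
      have h3 : k / ‖(r ^ 2 : ℝ)⁻¹ * circleMap 0 1 θ‖ ≤ 1 :=
        (div_le_one (by linarith)).mpr (by linarith)
      rw [norm_one]
      linarith
    · filter_upwards [hc] with θ hθ _
      have h1 : Filter.Tendsto (fun r : ℝ => (r ^ 2 : ℝ)⁻¹ * circleMap 0 1 θ)
          (nhdsWithin 1 (Set.Iio 1)) (nhds (circleMap 0 1 θ)) := by
        have : ContinuousAt (fun r : ℝ => ((r ^ 2 : ℝ) : ℂ)⁻¹ * circleMap 0 1 θ) 1 := by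
          refine ContinuousAt.mul (ContinuousAt.inv₀ (by fun_prop) (by simp)) (by fun_prop)
        simpa using this.tendsto.mono_left nhdsWithin_le_nhds
      exact (((hθ.tendsto.comp h1).const_add 1).norm).rpow_const (Or.inr hp.le)
  have hlim2 : Filter.Tendsto (fun r : ℝ => ∫ θ in (0 : ℝ)..2 * Real.pi,
      ‖1 + k * (r * circleMap 0 1 θ)‖ ^ p) (nhdsWithin 1 (Set.Iio 1))
      (nhds (∫ θ in (0 : ℝ)..2 * Real.pi, ‖1 + k * circleMap 0 1 θ‖ ^ p)) := by
    have : Continuous fun r : ℝ => ∫ θ in (0 : ℝ)..2 * Real.pi,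
        ‖1 + k * (r * circleMap 0 1 θ)‖ ^ p := by
      refine intervalIntegral.continuous_parametric_intervalIntegral_of_continuous' ?_ _ _
      refine Continuous.rpow_const ?_ fun _ => Or.inr hp.le
      have := (continuous_circleMap 0 1).comp (continuous_snd (X := ℝ) (Y := ℝ))
      simp only [Function.comp_def] at this
      fun_prop
    simpa using (this.tendsto 1).mono_left nhdsWithin_le_nhds
  refine le_of_tendsto_of_tendsto hlim1 hlim2 ?_
  filter_upwards [self_mem_nhdsWithin, eventually_nhdsWithin_of_eventually_nhds
    (lt_mem_nhds (zero_lt_one' ℝ))] with r h1 h2 using key r h2 h1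

/-! ### The derivative inequality without the minimum modulus. -/

/-- Convexity of `{s | |1 - s|² ≤ c |s|²}` for `c ≤ 1`, in summed form. -/
theorem Multiset.normSq_card_sub_sum_le {c : ℝ} (hc : c ≤ 1) (M : Multiset ℂ)
    (hM : ∀ s ∈ M, Complex.normSq (1 - s) ≤ c * Complex.normSq s) :
    Complex.normSq (M.card - M.sum) ≤ c * Complex.normSq M.sum := by
  induction M using Multiset.induction with
  | empty => simp
  | cons s M ih =>
    have h1 := hM s (Multiset.mem_cons_self s M)
    have h2 := ih fun t ht => hM t (Multiset.mem_cons_of_mem ht)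
    rw [Multiset.card_cons, Multiset.sum_cons]
    rcases Nat.eq_zero_or_pos M.card with h | h
    · rw [Multiset.card_eq_zero] at h
      simpa [h] using h1
    have hn : (0 : ℝ) < M.card := by exact_mod_cast h
    set n : ℝ := (M.card : ℝ) with hn'
    set T := M.sum
    rw [Complex.normSq_apply, Complex.normSq_apply] at h1 h2 ⊢
    simp only [Complex.sub_re, Complex.sub_im, Complex.add_re, Complex.add_im, Complex.one_re,
      Complex.one_im, Complex.natCast_re, Complex.natCast_im, Nat.cast_add, Nat.cast_one,
      ← hn'] at h1 h2 ⊢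
    -- With `Q_n(T) = |n - T|² - c|T|²`, adding `s` to `T` produces `Q_n(T) + Q_1(s)` plus twice a
    -- cross term; this square bounds `2n` times the cross term by `Q_n(T) + n² Q_1(s) ≤ 0`.
    have hsq : 0 ≤ (1 - c) * ((T.re - n * s.re) ^ 2 + (T.im - n * s.im) ^ 2) :=
      mul_nonneg (by linarith) (by positivity)
    have hcross : n * ((1 - c) * (T.re * s.re + T.im * s.im) - n * s.re - T.re + n) ≤ 0 := by
      nlinarith [mul_le_mul_of_nonneg_left h1 (sq_nonneg n)]
    have := nonpos_of_mul_nonpos_right hcross hn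
    nlinarith

/-- For a root `r`, `s = z/(z - r)` satisfies `|1 - s| = |r|/|z - r| ≤ (k/|z|) |s|`. Summing over
the roots preserves the bound by convexity, and the sum is `zP'/P`. -/
theorem Polynomial.norm_natDegree_mul_eval_sub_le {P : ℂ[X]} {k : ℝ} (hk : 0 < k)
    (hP : ∀ z, P.IsRoot z → ‖z‖ ≤ k) {z : ℂ} (hz : k ≤ ‖z‖) :
    ‖P.natDegree * P.eval z - z * P.derivative.eval z‖ ≤ k * ‖P.derivative.eval z‖ := by
  by_cases h0 : P.eval z = 0
  · rw [h0, mul_zero, zero_sub, norm_neg, norm_mul, le_antisymm (hP z h0) hz]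
  have hz0 : 0 < ‖z‖ := hk.trans_le hz
  have hzne : z ≠ 0 := norm_pos_iff.mp hz0
  have hspl : P.Splits := IsAlgClosed.splits P
  have hcard : P.roots.card = P.natDegree := hspl.natDegree_eq_card_roots.symm
  have hder := hspl.eval_derivative_eq_eval_mul_sum h0
  have hc : (k / ‖z‖) ^ 2 ≤ 1 := pow_le_one₀ (by positivity) ((div_le_one hz0).mpr hz)
  have hkey := Multiset.normSq_card_sub_sum_le hc (P.roots.map fun r => z * (1 / (z - r))) (by
    intro s hs
    obtain ⟨r, hr, rfl⟩ := Multiset.mem_map.mp hs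
    have hr' := isRoot_of_mem_roots hr
    have hzr : z - r ≠ 0 := fun h => h0 (by rw [sub_eq_zero.mp h]; exact hr')
    have h1 : 1 - z * (1 / (z - r)) = -r * (1 / (z - r)) := by field_simp; ring
    rw [h1, Complex.normSq_mul, Complex.normSq_mul, ← mul_assoc]
    refine mul_le_mul_of_nonneg_right ?_ (Complex.normSq_nonneg _)
    rw [Complex.normSq_neg, Complex.normSq_eq_norm_sq, Complex.normSq_eq_norm_sq, ← mul_pow,
      div_mul_cancel₀ _ hz0.ne']
    gcongr
    exact hP r hr')
  rw [Multiset.card_map, hcard, Multiset.sum_map_mul_left] at hkey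
  rw [hder]
  set S := (P.roots.map fun r => 1 / (z - r)).sum
  rw [Complex.normSq_eq_norm_sq, Complex.normSq_eq_norm_sq, ← mul_pow,
    pow_le_pow_iff_left₀ (norm_nonneg _) (by positivity) two_ne_zero, norm_mul, ← mul_assoc,
    div_mul_cancel₀ _ hz0.ne'] at hkey
  calc ‖P.natDegree * P.eval z - z * (P.eval z * S)‖ = ‖P.eval z‖ * ‖P.natDegree - z * S‖ := by
        rw [← norm_mul]; ring_nf
    _ ≤ ‖P.eval z‖ * (k * ‖S‖) := by gcongr
    _ = k * ‖P.eval z * S‖ := by rw [norm_mul]; ring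

/-! ### Minimum modulus and the sharpened derivative inequality. -/

theorem minModulus_nonneg (P : ℂ[X]) {k : ℝ} (hk : 0 ≤ k) : 0 ≤ minModulus P k := by
  obtain ⟨z, -, hz⟩ := (isLeast_minModulus P hk).1
  rw [← hz]
  exact norm_nonneg _

theorem minModulus_le (P : ℂ[X]) {k : ℝ} {z : ℂ} (hz : ‖z‖ = k) : minModulus P k ≤ ‖P.eval z‖ :=
  (isLeast_minModulus P (hz ▸ norm_nonneg z)).2 ⟨z, by simpa using hz, rfl⟩

theorem Polynomial.eval_reverse_inv_mul_pow (P : ℂ[X]) {z : ℂ} (hz : z ≠ 0) :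
    P.reverse.eval z⁻¹ * z ^ P.natDegree = P.eval z := by
  let := invertibleOfNonzero hz
  simpa [eval₂_eq_eval_map] using eval₂_reverse_mul_pow (RingHom.id ℂ) z P

/-- Reversal moves the exterior of `|z| < k`, with infinity, onto a disc. If `m > 0` the reversed
polynomial has no zero there, so the maximum principle applies to its inverse. -/
theorem minModulus_div_pow_le_norm_eval_reverse {P : ℂ[X]} (hP0 : P ≠ 0) {k : ℝ} (hk : 0 < k)
    (hP : ∀ z, P.IsRoot z → ‖z‖ ≤ k) {ζ : ℂ} (hζ : ‖ζ‖ ≤ k⁻¹) :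
    minModulus P k / k ^ P.natDegree ≤ ‖P.reverse.eval ζ‖ := by
  rcases (minModulus_nonneg P hk.le).eq_or_lt with hm | hm
  · simp [← hm]
  have hne (ζ : ℂ) (hζ : ‖ζ‖ ≤ k⁻¹) : P.reverse.eval ζ ≠ 0 := by
    rcases eq_or_ne ζ 0 with rfl | h
    · rw [← coeff_zero_eq_eval_zero, coeff_zero_reverse]
      exact leadingCoeff_ne_zero.mpr hP0
    intro h1
    have h2 := P.eval_reverse_inv_mul_pow (inv_ne_zero h)
    rw [inv_inv, h1, zero_mul] at h2
    have h3 : ‖ζ⁻¹‖ = k := by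
      refine le_antisymm (hP _ h2.symm) ?_
      rw [norm_inv]
      exact (le_inv_comm₀ (norm_pos_iff.mpr h) hk).mp hζ
    have h4 := minModulus_le P h3
    rw [← h2, norm_zero] at h4
    linarith
  have hcl : closure (Metric.ball (0 : ℂ) k⁻¹) = Metric.closedBall 0 k⁻¹ :=
    closure_ball _ (by positivity)
  have hd : DiffContOnCl ℂ (fun ζ => (P.reverse.eval ζ)⁻¹) (Metric.ball 0 k⁻¹) := by
    refine DiffContOnCl.inv P.reverse.differentiable.diffContOnCl fun ζ hζ => hne ζ ?_
    rw [hcl] at hζ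
    simpa using hζ
  have hmain := Complex.norm_le_of_forall_mem_frontier_norm_le Metric.isBounded_ball hd
    (C := (minModulus P k / k ^ P.natDegree)⁻¹) (fun ζ hζ => by
      rw [frontier_ball _ (by positivity), mem_sphere_zero_iff_norm] at hζ
      have h0 : ζ ≠ 0 := norm_pos_iff.mp (hζ ▸ by positivity)
      rw [norm_inv]
      refine inv_anti₀ (by positivity) ?_
      have h2 := P.eval_reverse_inv_mul_pow (inv_ne_zero h0)
      have h3 := minModulus_le P (z := ζ⁻¹) (k := k) (by rw [norm_inv, hζ, inv_inv])
      rw [← h2, inv_inv, norm_mul, norm_pow, norm_inv, hζ, inv_inv] at h3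
      exact (div_le_iff₀ (by positivity)).mpr h3)
    (z := ζ) (by rw [hcl]; simpa using hζ)
  rw [norm_inv] at hmain
  exact (inv_le_inv₀ (norm_pos_iff.mpr (hne ζ hζ)) (by positivity)).mp hmain

/-- Ensures that `P - l z^n` keeps degree `n` when `|l| < m/k^n`. -/
theorem minModulus_div_pow_le_norm_leadingCoeff {P : ℂ[X]} (hP0 : P ≠ 0) {k : ℝ} (hk : 0 < k)
    (hP : ∀ z, P.IsRoot z → ‖z‖ ≤ k) : minModulus P k / k ^ P.natDegree ≤ ‖P.leadingCoeff‖ := by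
  have := minModulus_div_pow_le_norm_eval_reverse hP0 hk hP (ζ := 0) (by simp [hk.le])
  rwa [← coeff_zero_eq_eval_zero, coeff_zero_reverse] at this

theorem minModulus_div_pow_mul_le_norm_eval {P : ℂ[X]} (hP0 : P ≠ 0) {k : ℝ} (hk : 0 < k)
    (hP : ∀ z, P.IsRoot z → ‖z‖ ≤ k) {z : ℂ} (hz : k ≤ ‖z‖) :
    minModulus P k / k ^ P.natDegree * ‖z‖ ^ P.natDegree ≤ ‖P.eval z‖ := by
  have hz0 : 0 < ‖z‖ := hk.trans_le hz
  rw [← P.eval_reverse_inv_mul_pow (norm_pos_iff.mp hz0), norm_mul, norm_pow]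
  gcongr
  refine minModulus_div_pow_le_norm_eval_reverse hP0 hk hP ?_
  rw [norm_inv]
  gcongr

/-- Outside the disc `|z| < k`, the modulus of the derivative dominates that of the conjugate
reciprocal part `n P - z P'`, with a gain governed by the minimum modulus. -/
theorem norm_natDegree_mul_eval_sub_add_minModulus_le {P : ℂ[X]} (hn : 1 ≤ P.natDegree) {k : ℝ}
    (hk : 0 < k) (hP : ∀ z, P.IsRoot z → ‖z‖ ≤ k) {z : ℂ} (hz : k ≤ ‖z‖) :
    ‖P.natDegree * P.eval z - z * P.derivative.eval z‖ +
        P.natDegree * minModulus P k / k ^ (P.natDegree - 1) * ‖z‖ ^ (P.natDegree - 1) ≤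
      k * ‖P.derivative.eval z‖ := by
  have hP0 : P ≠ 0 := by rintro rfl; simp at hn
  have hz0 : 0 < ‖z‖ := hk.trans_le hz
  have hzne : z ≠ 0 := norm_pos_iff.mp hz0
  set n := P.natDegree with hndef
  set μ := minModulus P k / k ^ n with hμ
  set d := P.derivative.eval z with hd
  set e : ℂ := n * z ^ (n - 1) with he
  set D := ‖n * P.eval z - z * d‖ with hD
  have he0 : e ≠ 0 := mul_ne_zero (by exact_mod_cast (by omega : n ≠ 0)) (pow_ne_zero _ hzne)
  have hepos : 0 < ‖e‖ := norm_pos_iff.mpr he0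
  have hze : z * e = n * z ^ n := by
    rw [he, mul_left_comm, ← pow_succ', Nat.sub_add_cancel hn]
  have hterm : n * minModulus P k / k ^ (n - 1) * ‖z‖ ^ (n - 1) = k * (μ * ‖e‖) := by
    have : k ^ n = k * k ^ (n - 1) := by rw [← pow_succ', Nat.sub_add_cancel hn]
    rw [hμ, he, norm_mul, norm_pow, Complex.norm_natCast, this]
    field_simp
  rw [hterm]
  have hevlt (l : ℂ) (hl : ‖l‖ < μ) (x : ℂ) (hx : k ≤ ‖x‖) : P.eval x - l * x ^ n ≠ 0 := by
    intro h
    have h1 := minModulus_div_pow_mul_le_norm_eval hP0 hk hP hx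
    rw [sub_eq_zero.mp h, norm_mul, norm_pow] at h1
    have h2 : 0 < ‖x‖ := hk.trans_le hx
    exact absurd (le_of_mul_le_mul_right h1 (by positivity)) (not_le.mpr hl)
  have hA (l : ℂ) (hl : ‖l‖ < μ) : D ≤ k * ‖d - l * e‖ := by
    set G : ℂ[X] := P - C l * X ^ n with hG
    have hdeg : G.natDegree = n := by
      refine natDegree_eq_of_le_of_coeff_ne_zero ?_ ?_
      · refine (natDegree_sub_le _ _).trans (max_le le_rfl (natDegree_C_mul_X_pow_le _ _))
      · rw [hG, coeff_sub, coeff_C_mul_X_pow, if_pos rfl]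
        intro h
        have h1 := minModulus_div_pow_le_norm_leadingCoeff hP0 hk hP
        rw [leadingCoeff, ← hndef, sub_eq_zero.mp h] at h1
        exact absurd h1 (not_le.mpr hl)
    have hGev (x : ℂ) : G.eval x = P.eval x - l * x ^ n := by simp [hG]
    have hGd : G.derivative.eval z = d - l * e := by
      rw [hG, derivative_sub, derivative_C_mul_X_pow, eval_sub, eval_mul, eval_pow, eval_C, eval_X]
      ring
    have h1 := G.norm_natDegree_mul_eval_sub_le hk (fun x hx => by
      by_contra! hlt
      exact hevlt l hl x hlt.le (by rw [← hGev]; exact hx)) hz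
    rw [hdeg, hGd, hGev] at h1
    refine le_trans (le_of_eq ?_) h1
    rw [hD]
    congr 1
    linear_combination -l * hze
  have hA0 : D ≤ k * ‖d‖ := P.norm_natDegree_mul_eval_sub_le hk hP hz
  rcases (minModulus_nonneg P hk.le).eq_or_lt with hm | hm
  · simpa [hμ, ← hm] using hA0
  have hμ0 : 0 < μ := by positivity
  -- Otherwise `l = d / e` is admissible and kills the right side of `hA`, which forces `P - l z^n`
  -- to vanish at `z`.
  have hde : μ * ‖e‖ ≤ ‖d‖ := by
    by_contra! h
    have hl : ‖d / e‖ < μ := by rwa [norm_div, div_lt_iff₀ hepos]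
    have h1 := hA (d / e) hl
    rw [div_mul_cancel₀ _ he0, sub_self, norm_zero, mul_zero] at h1
    have h2 : n * P.eval z - z * d = 0 := norm_le_zero_iff.mp h1
    refine hevlt _ hl z hz ?_
    have hn0 : (n : ℂ) ≠ 0 := by exact_mod_cast (by omega : n ≠ 0)
    refine (mul_eq_zero.mp ?_).resolve_left hn0
    have h3 : d / e * e = d := div_mul_cancel₀ _ he0
    linear_combination h2 - z * h3 + d / e * hze
  have hdpos : 0 < ‖d‖ := lt_of_lt_of_le (by positivity) hde
  have hx (x : ℝ) (hx0 : 0 ≤ x) (hxμ : x < μ) : D ≤ k * (‖d‖ - x * ‖e‖) := by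
    -- The argument of `l` aligns `l e` with `d`, so that `|d - l e| = |d| - x|e|`.
    set l : ℂ := x * ‖e‖ / e * (d / ‖d‖) with hl
    have hdne : (‖d‖ : ℂ) ≠ 0 := by exact_mod_cast hdpos.ne'
    have hlx : ‖l‖ = x := by
      simp [hl, abs_of_nonneg hx0, hepos.ne', hdpos.ne']
    have h1 := hA l (by rwa [hlx])
    have h2 : d - l * e = d / ‖d‖ * ((‖d‖ - x * ‖e‖ : ℝ) : ℂ) := by
      rw [hl]; push_cast; field_simp
    rw [h2, norm_mul, norm_div, Complex.norm_real, Complex.norm_real, norm_norm,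
      div_self hdpos.ne', one_mul, Real.norm_of_nonneg] at h1
    · exact h1
    · have : x * ‖e‖ ≤ μ * ‖e‖ := by gcongr
      linarith
  have hfin : μ ≤ (k * ‖d‖ - D) / (k * ‖e‖) := by
    refine le_of_forall_lt_imp_le_of_dense fun x hxμ => ?_
    rcases le_total 0 x with h | h
    · rw [le_div_iff₀ (by positivity)]
      linarith [hx x h hxμ]
    · exact h.trans (div_nonneg (by linarith) (by positivity))
  rw [le_div_iff₀ (by positivity)] at hfin
  linarith

/-! ### Pointwise bounds for the quotient and their integration. -/

theorem Polynomial.ae_eval_circleMap_ne_zero {Q : ℂ[X]} (hQ : Q ≠ 0) :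
    ∀ᵐ θ : ℝ, Q.eval (circleMap 0 1 θ) ≠ 0 := by
  have hfin : {z : ℂ | Q.IsRoot z}.Finite := Q.finite_setOfPred_isRoot hQ
  have := (hfin.countable.preimage_circleMap 0 one_ne_zero).ae_notMem volume
  filter_upwards [this] with θ hθ h using hθ h

section

variable {P : ℂ[X]} {k : ℝ} {β : ℂ}

/-- The function `w` for which `n (P(z) + m β / k^(n-1)) = z P'(z) (1 + w(z))`. -/
noncomputable def derivativeDefect (P : ℂ[X]) (k : ℝ) (β z : ℂ) : ℂ :=
  (P.natDegree * P.eval z - z * P.derivative.eval z +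
    P.natDegree * (minModulus P k * β / (k : ℂ) ^ (P.natDegree - 1))) /
      (z * P.derivative.eval z)

theorem natDegree_mul_eval_add_eq {z : ℂ} (hz : z ≠ 0) (hd : P.derivative.eval z ≠ 0) :
    P.natDegree * (P.eval z + minModulus P k * β / (k : ℂ) ^ (P.natDegree - 1)) =
      z * P.derivative.eval z * (1 + derivativeDefect P k β z) := by
  rw [derivativeDefect, mul_add _ 1, mul_div_cancel₀ _ (mul_ne_zero hz hd)]
  ring

theorem norm_derivativeDefect_le (hn : 1 ≤ P.natDegree) (hk0 : 0 < k) (hk1 : k ≤ 1)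
    (hP : ∀ z, P.IsRoot z → ‖z‖ ≤ k) (hβ : ‖β‖ ≤ 1) {z : ℂ} (hz : 1 ≤ ‖z‖) :
    ‖derivativeDefect P k β z‖ ≤ k / ‖z‖ := by
  have hz0 : 0 < ‖z‖ := by linarith
  -- When `k = 1`, `P'` may vanish on `|z| = 1`; division by zero then gives the value 0.
  rcases eq_or_ne (P.derivative.eval z) 0 with hd | hd
  · simp only [derivativeDefect, hd, mul_zero, div_zero, norm_zero]
    positivity
  have hmain := norm_natDegree_mul_eval_sub_add_minModulus_le hn hk0 hP (hk1.trans hz)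
  have hm := minModulus_nonneg P hk0.le
  have hterm : ‖P.natDegree * (minModulus P k * β / (k : ℂ) ^ (P.natDegree - 1))‖ ≤
      P.natDegree * minModulus P k / k ^ (P.natDegree - 1) * ‖z‖ ^ (P.natDegree - 1) := by
    rw [norm_mul, norm_div, norm_mul, norm_pow, Complex.norm_natCast, Complex.norm_real,
      Complex.norm_real, Real.norm_of_nonneg hm, Real.norm_of_nonneg hk0.le]
    calc (P.natDegree : ℝ) * (minModulus P k * ‖β‖ / k ^ (P.natDegree - 1))
        ≤ P.natDegree * (minModulus P k * 1 / k ^ (P.natDegree - 1)) := by gcongr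
      _ = P.natDegree * minModulus P k / k ^ (P.natDegree - 1) * 1 := by ring
      _ ≤ _ := by gcongr; exact one_le_pow₀ hz
  rw [derivativeDefect, norm_div, norm_mul,
    div_le_div_iff₀ (mul_pos hz0 (norm_pos_iff.mpr hd)) hz0]
  calc _ ≤ (k * ‖P.derivative.eval z‖) * ‖z‖ := by
        gcongr
        exact (norm_add_le _ _).trans (by linarith)
    _ = _ := by ring

/-- Gauss–Lucas for a centred disc: at a critical point the derivative inequality would force `P =
0`. -/
theorem eval_derivative_ne_zero_of_lt_norm (hn : 1 ≤ P.natDegree) (hk0 : 0 < k)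
    (hP : ∀ z, P.IsRoot z → ‖z‖ ≤ k) {z : ℂ} (hz : k < ‖z‖) : P.derivative.eval z ≠ 0 := by
  intro hd
  have h := P.norm_natDegree_mul_eval_sub_le hk0 hP hz.le
  rw [hd, mul_zero, sub_zero, norm_zero, mul_zero, norm_le_zero_iff] at h
  have hn0 : (P.natDegree : ℂ) ≠ 0 := by exact_mod_cast (by omega : P.natDegree ≠ 0)
  exact absurd (hP z ((mul_eq_zero.mp h).resolve_left hn0)) (not_le.mpr hz)

theorem differentiableAt_derivativeDefect {z : ℂ} (hz : z ≠ 0) (hd : P.derivative.eval z ≠ 0) :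
    DifferentiableAt ℂ (derivativeDefect P k β) z := by
  unfold derivativeDefect
  refine DifferentiableAt.div ?_ ?_ (mul_ne_zero hz hd)
  · have := P.differentiableAt (x := z)
    have := P.derivative.differentiableAt (x := z)
    fun_prop
  · have := P.derivative.differentiableAt (x := z)
    fun_prop

theorem ae_eval_derivative_circleMap_ne_zero (hn : 1 ≤ P.natDegree) :
    ∀ᵐ θ : ℝ, P.derivative.eval (circleMap 0 1 θ) ≠ 0 := by
  refine ae_eval_circleMap_ne_zero fun h => ?_
  have := derivative_eq_zero.mp h
  omega

theorem integral_norm_one_add_derivativeDefect_rpow_le (hn : 1 ≤ P.natDegree) (hk0 : 0 < k)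
    (hk1 : k ≤ 1) (hP : ∀ z, P.IsRoot z → ‖z‖ ≤ k) (hβ : ‖β‖ ≤ 1) {p : ℝ} (hp : 0 < p) :
    ∫ θ in (0 : ℝ)..2 * Real.pi, ‖1 + derivativeDefect P k β (circleMap 0 1 θ)‖ ^ p ≤
      ∫ θ in (0 : ℝ)..2 * Real.pi, ‖1 + k * circleMap 0 1 θ‖ ^ p := by
  refine integral_norm_one_add_rpow_le hk0 hk1 hp (fun z hz => ?_)
    (fun z hz => norm_derivativeDefect_le hn hk0 hk1 hP hβ hz) (by simp [derivativeDefect]) ?_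
  · refine differentiableAt_derivativeDefect (norm_pos_iff.mp (by linarith)) ?_
    exact eval_derivative_ne_zero_of_lt_norm hn hk0 hP (hk1.trans_lt hz)
  · filter_upwards [ae_eval_derivative_circleMap_ne_zero hn] with θ hθ
    exact (differentiableAt_derivativeDefect (circleMap_ne_center one_ne_zero) hθ).continuousAt

theorem exp_mul_I_eq_circleMap (θ : ℝ) : Complex.exp (θ * Complex.I) = circleMap 0 1 θ := by
  simp [circleMap]

theorem mul_norm_derivative_le_polarDenom (hn : 1 ≤ P.natDegree) (hk0 : 0 < k) (hk1 : k ≤ 1)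
    (hP : ∀ z, P.IsRoot z → ‖z‖ ≤ k) (α : ℂ) (θ : ℝ) :
    (‖α‖ - k) * ‖P.derivative.eval (circleMap 0 1 θ)‖ ≤ polarDenom P k α θ := by
  have h := norm_natDegree_mul_eval_sub_add_minModulus_le hn hk0 hP
    (z := circleMap 0 1 θ) (by simpa using hk1)
  rw [norm_circleMap_zero, abs_one, one_pow, mul_one] at h
  rw [polarDenom, polarDeriv, exp_mul_I_eq_circleMap]
  set z := circleMap 0 1 θ
  have h1 : eval z ((P.natDegree : ℂ[X]) * P + (C α - X) * derivative P) =
      α * P.derivative.eval z + (P.natDegree * P.eval z - z * P.derivative.eval z) := by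
    simp only [eval_add, eval_mul, eval_sub, eval_C, eval_X, eval_natCast]
    ring
  have h2 := norm_sub_le_norm_add (α * P.derivative.eval z)
    (P.natDegree * P.eval z - z * P.derivative.eval z)
  rw [norm_mul] at h2
  rw [h1]
  linarith

theorem ae_polarDenom_pos (hn : 1 ≤ P.natDegree) (hk0 : 0 < k) (hk1 : k ≤ 1)
    (hP : ∀ z, P.IsRoot z → ‖z‖ ≤ k) {α : ℂ} (hα : k < ‖α‖) :
    ∀ᵐ θ : ℝ, 0 < polarDenom P k α θ := by
  filter_upwards [ae_eval_derivative_circleMap_ne_zero hn] with θ hθ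
  exact (mul_pos (sub_pos.mpr hα) (norm_pos_iff.mpr hθ)).trans_le
    (mul_norm_derivative_le_polarDenom hn hk0 hk1 hP α θ)

theorem ae_mul_norm_polarQuotient_le (hn : 1 ≤ P.natDegree) (hk0 : 0 < k) (hk1 : k ≤ 1)
    (hP : ∀ z, P.IsRoot z → ‖z‖ ≤ k) {α : ℂ} (hα : k < ‖α‖) :
    ∀ᵐ θ : ℝ, P.natDegree * (‖α‖ - k) * ‖polarQuotient P k α β θ‖ ≤
      ‖1 + derivativeDefect P k β (circleMap 0 1 θ)‖ := by
  filter_upwards [ae_eval_derivative_circleMap_ne_zero hn,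
    ae_polarDenom_pos hn hk0 hk1 hP hα] with θ hθ hpos
  have hden := mul_norm_derivative_le_polarDenom hn hk0 hk1 hP α θ
  have hnum := congrArg norm (natDegree_mul_eval_add_eq (k := k) (β := β)
    (circleMap_ne_center one_ne_zero : circleMap 0 1 θ ≠ 0) hθ)
  rw [norm_mul, norm_mul, norm_mul, Complex.norm_natCast, norm_circleMap_zero, abs_one,
    one_mul] at hnum
  rw [polarQuotient, exp_mul_I_eq_circleMap, norm_div, Complex.norm_real,
    Real.norm_of_nonneg hpos.le, ← mul_div_assoc, div_le_iff₀ hpos]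
  calc _ = (‖α‖ - k) * ‖P.derivative.eval (circleMap 0 1 θ)‖ *
        ‖1 + derivativeDefect P k β (circleMap 0 1 θ)‖ := by linear_combination (‖α‖ - k) * hnum
    _ ≤ polarDenom P k α θ * ‖1 + derivativeDefect P k β (circleMap 0 1 θ)‖ := by gcongr
    _ = _ := mul_comm _ _

theorem measurable_polarQuotient (α : ℂ) : Measurable (polarQuotient P k α β) := by
  have hcont (Q : ℂ[X]) : Continuous fun θ : ℝ => Q.eval (Complex.exp (θ * Complex.I)) :=
    Q.continuous.comp (by fun_prop)
  have h1 : Measurable (polarDenom P k α) :=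
    ((hcont (polarDeriv α P)).norm.sub continuous_const).measurable
  exact ((hcont P).measurable.add_const _).div (Complex.measurable_ofReal.comp h1)

theorem intervalIntegrable_norm_rpow_of_ae_le {f : ℝ → ℂ} (hf : Measurable f) {B p : ℝ}
    (hp : 0 ≤ p) (hB : ∀ᵐ θ : ℝ, ‖f θ‖ ≤ B) (a b : ℝ) :
    IntervalIntegrable (fun θ => ‖f θ‖ ^ p) volume a b := by
  refine (intervalIntegrable_const (c := B ^ p)).mono_fun'
    (hf.norm.pow_const p).aestronglyMeasurable ?_
  filter_upwards [ae_restrict_of_ae hB] with θ hθ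
  rw [Real.norm_of_nonneg (by positivity)]
  gcongr

theorem measurable_derivativeDefect : Measurable (derivativeDefect P k β) := by
  unfold derivativeDefect
  have h1 := P.continuous.measurable
  have h2 := P.derivative.continuous.measurable
  fun_prop

theorem ae_norm_polarQuotient_le (hn : 1 ≤ P.natDegree) (hk0 : 0 < k) (hk1 : k ≤ 1)
    (hP : ∀ z, P.IsRoot z → ‖z‖ ≤ k) (hβ : ‖β‖ ≤ 1) {α : ℂ} (hα : k < ‖α‖) :
    ∀ᵐ θ : ℝ, ‖polarQuotient P k α β θ‖ ≤ (1 + k) / (P.natDegree * (‖α‖ - k)) := by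
  filter_upwards [ae_mul_norm_polarQuotient_le (β := β) hn hk0 hk1 hP hα] with θ hθ
  have hn0 : (0 : ℝ) < P.natDegree := by exact_mod_cast hn
  rw [le_div_iff₀ (mul_pos hn0 (sub_pos.mpr hα)), mul_comm]
  refine hθ.trans ((norm_add_le _ _).trans ?_)
  have := norm_derivativeDefect_le hn hk0 hk1 hP hβ (z := circleMap 0 1 θ) (by simp)
  simp only [norm_circleMap_zero, abs_one, div_one] at this
  rw [norm_one]
  linarith

theorem mul_integral_norm_polarQuotient_rpow_le (hn : 1 ≤ P.natDegree) (hk0 : 0 < k) (hk1 : k ≤ 1)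
    (hP : ∀ z, P.IsRoot z → ‖z‖ ≤ k) (hβ : ‖β‖ ≤ 1) {α : ℂ} (hα : k < ‖α‖) {p : ℝ} (hp : 0 < p) :
    P.natDegree * (‖α‖ - k) *
        (∫ θ in (0 : ℝ)..2 * Real.pi, ‖polarQuotient P k α β θ‖ ^ p) ^ (1 / p) ≤
      (∫ θ in (0 : ℝ)..2 * Real.pi, ‖1 + k * circleMap 0 1 θ‖ ^ p) ^ (1 / p) := by
  have hpi : (0 : ℝ) ≤ 2 * Real.pi := Real.two_pi_pos.le
  set c : ℝ := P.natDegree * (‖α‖ - k) with hc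
  have hc0 : 0 ≤ c := mul_nonneg (Nat.cast_nonneg _) (sub_pos.mpr hα).le
  have hI : 0 ≤ ∫ θ in (0 : ℝ)..2 * Real.pi, ‖polarQuotient P k α β θ‖ ^ p :=
    intervalIntegral.integral_nonneg hpi fun θ _ => by positivity
  have hcp : c = (c ^ p) ^ (1 / p) := by rw [one_div, Real.rpow_rpow_inv hc0 hp.ne']
  rw [hcp, ← Real.mul_rpow (by positivity) hI]
  refine Real.rpow_le_rpow (by positivity) ?_ (by positivity)
  rw [← intervalIntegral.integral_const_mul]
  refine le_trans (intervalIntegral.integral_mono_ae hpi ?_ ?_ ?_)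
    (integral_norm_one_add_derivativeDefect_rpow_le hn hk0 hk1 hP hβ hp)
  · exact (intervalIntegrable_norm_rpow_of_ae_le (measurable_polarQuotient α) hp.le
      (ae_norm_polarQuotient_le hn hk0 hk1 hP hβ hα) _ _).const_mul _
  · refine intervalIntegrable_norm_rpow_of_ae_le (B := 1 + k) ?_ hp.le ?_ _ _
    · exact (measurable_derivativeDefect.comp (continuous_circleMap 0 1).measurable).const_add _
    · refine Filter.Eventually.of_forall fun θ => (norm_add_le _ _).trans ?_
      have := norm_derivativeDefect_le hn hk0 hk1 hP hβ (z := circleMap 0 1 θ) (by simp)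
      simp only [norm_circleMap_zero, abs_one, div_one] at this
      rw [norm_one]
      linarith
  · filter_upwards [ae_mul_norm_polarQuotient_le (β := β) hn hk0 hk1 hP hα] with θ hθ
    rw [← Real.mul_rpow hc0 (norm_nonneg _)]
    exact Real.rpow_le_rpow (by positivity) hθ hp.le

end

/-! ### The extremal polynomial `(z - k)^n`. -/

theorem minModulus_X_sub_C_pow {n : ℕ} (hn : 1 ≤ n) {k : ℝ} (hk : 0 ≤ k) :
    minModulus ((X - C (k : ℂ)) ^ n) k = 0 := by
  refine le_antisymm ?_ (minModulus_nonneg _ hk)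
  have := minModulus_le ((X - C (k : ℂ)) ^ n) (z := k) (k := k) (by simp [abs_of_nonneg hk])
  simpa [zero_pow (by omega : n ≠ 0)] using this

/-- Here `m = 0`, so `β` drops out, and `D_α P = n(α - k)(z - k)^(n-1)`. -/
theorem ae_mul_norm_polarQuotient_X_sub_C_pow {n : ℕ} (hn : 1 ≤ n) {k : ℝ} (hk : 0 ≤ k) {α : ℝ}
    (hα : k < α) (β : ℂ) : ∀ᵐ θ : ℝ,
    n * (α - k) * ‖polarQuotient ((X - C (k : ℂ)) ^ n) k α β θ‖ = ‖circleMap 0 1 θ - k‖ := by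
  filter_upwards [ae_eval_circleMap_ne_zero (X_sub_C_ne_zero (k : ℂ))] with θ hθ
  rw [eval_sub, eval_X, eval_C] at hθ
  have hdeg : ((X - C (k : ℂ)) ^ n).natDegree = n := by simp
  rw [polarQuotient, polarDenom, polarDeriv, hdeg, minModulus_X_sub_C_pow hn hk,
    exp_mul_I_eq_circleMap]
  set z := circleMap 0 1 θ
  obtain ⟨j, rfl⟩ : ∃ j, n = j + 1 := ⟨n - 1, by omega⟩
  have h1 : eval z (((j + 1 : ℕ) : ℂ[X]) * (X - C (k : ℂ)) ^ (j + 1) +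
      (C (α : ℂ) - X) * derivative ((X - C (k : ℂ)) ^ (j + 1))) =
      ((j + 1 : ℕ) * (α - k) : ℝ) * (z - k) ^ j := by
    simp [derivative_X_sub_C_pow]
    ring
  have hz : 0 < ‖z - k‖ := norm_pos_iff.mpr hθ
  have hαk : 0 < α - k := sub_pos.mpr hα
  rw [h1]
  simp only [Complex.ofReal_zero, zero_mul, zero_div, add_zero, mul_zero, sub_zero, eval_pow,
    eval_sub, eval_X, eval_C, norm_div, norm_mul, norm_pow, Complex.norm_real, norm_norm]
  rw [Real.norm_natCast, Real.norm_of_nonneg hαk.le]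
  field_simp
  exact pow_succ _ _

/-- On the unit circle `|z⁻¹ - k| = |1 - kz|`; inversion and rotation by `π` preserve the mean. -/
theorem integral_norm_circleMap_sub_rpow (k p : ℝ) :
    ∫ θ in (0 : ℝ)..2 * Real.pi, ‖circleMap 0 1 θ - k‖ ^ p =
      ∫ θ in (0 : ℝ)..2 * Real.pi, ‖1 + k * circleMap 0 1 θ‖ ^ p := by
  have hpi : (2 * Real.pi)⁻¹ ≠ 0 := inv_ne_zero Real.two_pi_pos.ne'
  have hshift (θ : ℝ) : circleMap 0 1 (θ + Real.pi) = -circleMap 0 1 θ := by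
    simp [circleMap, add_mul, Complex.exp_add]
  have h1 : Real.circleAverage (fun z : ℂ => ‖1 + k * z‖ ^ p) 0 1 =
      Real.circleAverage (fun z : ℂ => ‖1 - k * z‖ ^ p) 0 1 := by
    rw [Real.circleAverage_eq_integral_add Real.pi, Real.circleAverage_def]
    simp only [hshift, mul_neg, ← sub_eq_add_neg]
  have h2 : Real.circleAverage (fun z : ℂ => ‖z⁻¹ - k‖ ^ p) 0 1 =
      Real.circleAverage (fun z : ℂ => ‖1 - k * z‖ ^ p) 0 1 := by
    refine Real.circleAverage_congr_sphere fun z hz => ?_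
    rw [abs_one, mem_sphere_zero_iff_norm] at hz
    have hz0 : z ≠ 0 := norm_pos_iff.mp (hz ▸ one_pos)
    have : 1 - k * z = z * (z⁻¹ - k) := by field_simp
    simp only [this, norm_mul, hz, one_mul]
  rw [← h1, Real.circleAverage_zero_one_congr_inv (f := fun z : ℂ => ‖z - k‖ ^ p),
    Real.circleAverage_def, Real.circleAverage_def] at h2
  exact smul_right_injective ℝ hpi h2

/-! ### The inequality and its sharpness. -/

theorem theorem1 (n : ℕ) (hn : 1 ≤ n) (k : ℝ) (hk0 : 0 < k) (hk1 : k ≤ 1)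
    (β : ℂ) (hβ : ‖β‖ ≤ 1) (p : ℝ) (hp : 0 < p) :
    (∀ P : ℂ[X], P.natDegree = n → (∀ z : ℂ, P.IsRoot z → ‖z‖ ≤ k) →
      ∀ α : ℂ, k ≤ ‖α‖ →
        (k < ‖α‖ →
          (∀ᵐ θ : ℝ, polarDenom P k α θ ≠ 0) ∧
          IntervalIntegrable (fun θ : ℝ => ‖polarQuotient P k α β θ‖ ^ p) volume
            0 (2 * Real.pi)) ∧
        n * (‖α‖ - k) * (∫ θ in (0 : ℝ)..2 * Real.pi, ‖polarQuotient P k α β θ‖ ^ p) ^ (1 / p)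
          ≤ (∫ θ in (0 : ℝ)..2 * Real.pi,
              ‖(1 : ℂ) + k * Complex.exp (θ * Complex.I)‖ ^ p) ^ (1 / p)) ∧
    (∀ α : ℝ, k < α →
        n * (|α| - k) * (∫ θ in (0 : ℝ)..2 * Real.pi,
            ‖polarQuotient ((X - C (k : ℂ)) ^ n) k (α : ℂ) β θ‖ ^ p) ^ (1 / p)
          = (∫ θ in (0 : ℝ)..2 * Real.pi,
              ‖(1 : ℂ) + k * Complex.exp (θ * Complex.I)‖ ^ p) ^ (1 / p)) := by
  have hpi : (0 : ℝ) ≤ 2 * Real.pi := Real.two_pi_pos.le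
  simp only [exp_mul_I_eq_circleMap]
  refine ⟨?_, fun α hα => ?_⟩
  · rintro P rfl hP α hα
    refine ⟨fun hα' => ⟨(ae_polarDenom_pos hn hk0 hk1 hP hα').mono fun _ h => h.ne', ?_⟩, ?_⟩
    · exact intervalIntegrable_norm_rpow_of_ae_le (measurable_polarQuotient α) hp.le
        (ae_norm_polarQuotient_le hn hk0 hk1 hP hβ hα') _ _
    · rcases hα.eq_or_lt with h | h
      · rw [← h, sub_self, mul_zero, zero_mul]
        exact Real.rpow_nonneg
          (intervalIntegral.integral_nonneg hpi fun θ _ => by positivity) _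
      · exact mul_integral_norm_polarQuotient_rpow_le hn hk0 hk1 hP hβ h hp
  · rw [abs_of_pos (hk0.trans hα)]
    set c : ℝ := n * (α - k) with hc
    have hc0 : 0 ≤ c := mul_nonneg (Nat.cast_nonneg _) (sub_pos.mpr hα).le
    have hcp : c = (c ^ p) ^ (1 / p) := by rw [one_div, Real.rpow_rpow_inv hc0 hp.ne']
    rw [hcp, ← Real.mul_rpow (by positivity)
      (intervalIntegral.integral_nonneg hpi fun θ _ => by positivity),
      ← intervalIntegral.integral_const_mul, ← integral_norm_circleMap_sub_rpow]
    congr 1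
    refine intervalIntegral.integral_congr_ae ?_
    filter_upwards [ae_mul_norm_polarQuotient_X_sub_C_pow hn hk0.le hα β] with θ hθ _
    rw [← Real.mul_rpow hc0 (norm_nonneg _), hθ]
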